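/- Let $\Gamma$ be a countably infinite discrete group acting on $\mathbb{N}^\Gamma$ (with the product topology, $\mathbb{N}$ discrete) by the shift $(\gamma\cdot\omega)(\delta)=\omega(\delta\gamma)$. A \emph{subshift} is a closed shift-invariant (possibly empty) subset of $\mathbb{N}^\Gamma$; let $\mathcal{S}_0(\Gamma,\mathbb{N})$ be the set of all subshifts. For a subshift $\Omega$ let $\mathrm{Fin}(\Omega)$ be the set of all partial functions $\phi\colon\Gamma\rightharpoonup\mathbb{N}$ with finite domain that extend to some $\omega\in\Omega$, and give $\mathcal{S}_0(\Gamma,\mathbb{N})$ the topology generated by the sets $\{\Omega : \phi\in\mathrm{Fin}(\Omega)\}$ and $\{\Omega : \phi\notin\mathrm{Fin}(\Omega)\}$, where $\phi$ ranges over all finite partial functions. Let $\alpha$ be a continuous action of $\Gamma$ on a Polish space $X$. A map from $X$ to a standard Borel space $Y$ is \emph{Baire measurable} if preimages of Borel sets have the Baire property. Let $\mathcal{S}_{\mathrm{BM}}(\alpha,\mathbb{N})$ be the set of all $\Omega\in\mathcal{S}_0(\Gamma,\mathbb{N})$ for which there is a Baire measurable $f\colon X\to\mathbb{N}$ such that $\{x\in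 X : (f(\gamma\cdot x))_{\gamma\in\Gamma}\in\Omega\}$ is comeager. Let $[X,\mathbb{N}^\Gamma]$ be the set of all Baire measurable maps $X\to\mathbb{N}^\Gamma$ modulo equality on a comeager set, with the $\sigma$-algebra generated by the sets $\{\pi : U\setminus\pi^{-1}(A)\text{ is meager}\}$ for $U\subseteq X$ nonempty open and $A\subseteq\mathbb{N}^\Gamma$ Borel, and let $\mathrm{Hom}(\alpha,\sigma)\subseteq[X,\mathbb{N}^\Gamma]$ be the set of all (classes of) maps that are equivariant on a comeager set, with the induced $\sigma$-algebra. Then $\mathcal{S}_0(\Gamma,\mathbb{N})$ is a Polish space and $\mathcal{S}_{\mathrm{BM}}(\alpha,\mathbb{N})$ is an analytic subset of it. Moreover, $\mathrm{Hom}(\alpha,\sigma)$ is a measurable subset of $[X,\mathbb{N}^\Gamma]$ and a standard Borel space, the set $$\{(\pi,\Omega)\in\mathrm{Hom}(\alpha,\sigma)\times\mathcal{S}_0(\Gamma,\mathbb{N}) : \pi^{-1}(\Omega)\text{ is comeager}\}$$ is a Borel subset of $\mathrm{Hom}(\alpha,\sigma)\times\mathcal{S}_0(\Gamma,\mathbb{N})$,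 and $\mathcal{S}_{\mathrm{BM}}(\alpha,\mathbb{N})$ is its projection to $\mathcal{S}_0(\Gamma,\mathbb{N})$. -/

import Mathlib

open Set Filter Topology MeasureTheory

namespace GenericColoring

universe u v w

section Shift

variable {Γ : Type u} [Group Γ] {A : Type v}

/-- The shift action of `Γ` on `A ^ Γ`: `(γ · ω)(δ) = ω(δ γ)`. -/
def shift (γ : Γ) (ω : Γ → A) : Γ → A := fun δ => ω (δ * γ)

end Shift

/-- A subshift: a closed shift-invariant subset of `ℕ ^ Γ` (possibly empty), where `ℕ` is discrete
and `ℕ ^ Γ` has the product topology. -/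
@[ext]
structure Subshift (Γ : Type u) [Group Γ] where
  carrier : Set (Γ → ℕ)
  isClosed : IsClosed carrier
  shift_mem : ∀ (γ : Γ), ∀ ω ∈ carrier, shift γ ω ∈ carrier

/-- Partial functions from `Γ` to `ℕ` with finite domain. -/
abbrev FinPartial (Γ : Type u) : Type u := Σ S : Finset Γ, (S → ℕ)

namespace Subshift

variable {Γ : Type u} [Group Γ]

/-- The finite partial functions that are restrictions of members of `Ω`. -/
def finPatterns (Ω : Subshift Γ) : Set (FinPartial Γ) :=
  {φ | ∃ ω ∈ Ω.carrier, ∀ γ : φ.1, ω γ = φ.2 γ}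

/-- The topology on the space of subshifts generated by the sets
`{Ω | φ ∈ Fin(Ω)}` and `{Ω | φ ∉ Fin(Ω)}`, where `φ` ranges over the finite partial functions. -/
instance : TopologicalSpace (Subshift Γ) :=
  TopologicalSpace.generateFrom
    {V | ∃ φ : FinPartial Γ, V = {Ω : Subshift Γ | φ ∈ Ω.finPatterns} ∨
      V = {Ω : Subshift Γ | φ ∉ Ω.finPatterns}}

instance : MeasurableSpace (Subshift Γ) := borel (Subshift Γ)

instance : BorelSpace (Subshift Γ) := ⟨rfl⟩

end Subshift

section BaireMaps

/-- A map from a topological space to a measurable space is Baire measurable if preimages of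
measurable sets have the Baire property. -/
def IsBaireMeasurable {X : Type v} [TopologicalSpace X] {Y : Type w} [MeasurableSpace Y]
    (f : X → Y) : Prop :=
  ∀ B : Set Y, MeasurableSet B → BaireMeasurableSet (f ⁻¹' B)

/-- Equality on a comeager set, as an equivalence relation on Baire measurable maps. -/
def starEq (X : Type v) [TopologicalSpace X] (Y : Type w) [MeasurableSpace Y] :
    Setoid {f : X → Y // IsBaireMeasurable f} where
  r f g := {x | f.1 x = g.1 x} ∈ residual X
  iseqv :=
    { refl := fun f => EventuallyEq.refl (residual X) f.1
      symm := fun {f g} h => EventuallyEq.symm (l := residual X) (f := f.1) (g := g.1) h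
      trans := fun {f g k} h₁ h₂ =>
        EventuallyEq.trans (l := residual X) (f := f.1) (g := g.1) (h := k.1) h₁ h₂ }

/-- The set `[X, Y]` of Baire measurable maps from `X` to `Y`, modulo equality on a comeager
set. -/
def BaireMap (X : Type v) [TopologicalSpace X] (Y : Type w) [MeasurableSpace Y] :
    Type (max v w) :=
  Quotient (starEq X Y)

namespace BaireMap

variable {X : Type v} [TopologicalSpace X] {Y : Type w} [MeasurableSpace Y]

/-- `π ⁻¹(A)` is comeager. -/
def ComeagerPreimage (A : Set Y) (π : BaireMap X Y) : Prop :=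
  Quotient.lift (s := starEq X Y) (fun f => f.1 ⁻¹' A ∈ residual X)
    (by
      have key : ∀ f g : {f : X → Y // IsBaireMeasurable f}, starEq X Y f g →
          f.1 ⁻¹' A ∈ residual X → g.1 ⁻¹' A ∈ residual X := by
        intro f g h hf
        filter_upwards [h, hf] with x hx hxA
        have hx' : f.1 x = g.1 x := hx
        simpa [← hx'] using hxA
      exact fun f g h => propext ⟨key f g h, key g f ((starEq X Y).symm h)⟩) π

/-- `U` forces `π ⁻¹(A)`, i.e. `U \ π ⁻¹(A)` is meager. -/
def Forces (U : Set X) (A : Set Y) (π : BaireMap X Y) : Prop :=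
  Quotient.lift (s := starEq X Y) (fun f => IsMeagre (U \ f.1 ⁻¹' A))
    (by
      have key : ∀ f g : {f : X → Y // IsBaireMeasurable f}, starEq X Y f g →
          IsMeagre (U \ f.1 ⁻¹' A) → IsMeagre (U \ g.1 ⁻¹' A) := by
        intro f g h hf
        unfold IsMeagre at hf ⊢
        filter_upwards [h, hf] with x hx hxA
        have hx' : f.1 x = g.1 x := hx
        simpa [← hx'] using hxA
      exact fun f g h => propext ⟨key f g h, key g f ((starEq X Y).symm h)⟩) π

/-- The `σ`-algebra on `[X, Y]` generated by the sets `[U, A]` of all `π` such that `U` forces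
`π ⁻¹(A)`, for `U ⊆ X` nonempty open and `A ⊆ Y` Borel. -/
instance : MeasurableSpace (BaireMap X Y) :=
  MeasurableSpace.generateFrom
    {S | ∃ (U : Set X) (A : Set Y), IsOpen U ∧ U.Nonempty ∧ MeasurableSet A ∧
      S = {π : BaireMap X Y | Forces U A π}}

end BaireMap

end BaireMaps

section Colorings

variable (Γ : Type u) [Group Γ] [Countable Γ]
  (X : Type v) [TopologicalSpace X] [MulAction Γ X] [ContinuousConstSMul Γ X]

/-- The map `π : X → ℕ ^ Γ` is equivariant on a comeager set; well defined on classes. -/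
def IsGenericallyEquivariant (π : BaireMap X (Γ → ℕ)) : Prop :=
  Quotient.lift (s := starEq X (Γ → ℕ))
    (fun f => {x | ∀ γ : Γ, f.1 (γ • x) = shift γ (f.1 x)} ∈ residual X)
    (by
      have key : ∀ f g : {f : X → (Γ → ℕ) // IsBaireMeasurable f}, starEq X (Γ → ℕ) f g →
          {x | ∀ γ : Γ, f.1 (γ • x) = shift γ (f.1 x)} ∈ residual X →
          {x | ∀ γ : Γ, g.1 (γ • x) = shift γ (g.1 x)} ∈ residual X := by
        intro f g h hf
        have h' : ∀ᶠ x in residual X, f.1 x = g.1 x := h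
        have h'' : ∀ᶠ x in residual X, ∀ γ : Γ, f.1 (γ • x) = g.1 (γ • x) :=
          eventually_countable_forall.2 fun γ =>
            (tendsto_residual_of_isOpenMap (Homeomorph.smul γ).continuous
              (Homeomorph.smul γ).isOpenMap).eventually h'
        filter_upwards [h', h'', hf] with x hx hγ hfx γ
        rw [← hγ γ, ← hx]
        exact hfx γ
      exact fun f g h => propext ⟨key f g h, key g f ((starEq X (Γ → ℕ)).symm h)⟩) π

/-- The set `Hom(α, σ)` of all classes in `[X, ℕ ^ Γ]` of maps that are equivariant on a comeager
set, where `α` is the given action of `Γ` on `X` and `σ` is the shift action on `ℕ ^ Γ`. -/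
def Hom : Set (BaireMap X (Γ → ℕ)) := {π | IsGenericallyEquivariant Γ X π}

variable {Γ X} in
/-- The coding map `π_f : X → ℕ ^ Γ` of `f : X → ℕ`, given by `π_f(x)(γ) = f(γ · x)`. -/
def codingMap (f : X → ℕ) (x : X) : Γ → ℕ := fun γ => f (γ • x)

/-- The set `S_BM(α, ℕ)` of all subshifts `Ω` for which there is a Baire measurable `Ω`-coloring of
the given action `α` of `Γ` on `X`, i.e. a Baire measurable `f : X → ℕ` such that the preimage of
`Ω` under the coding map of `f` is comeager. -/
def baireColorable : Set (Subshift Γ) :=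
  {Ω | ∃ f : X → ℕ, IsBaireMeasurable f ∧ codingMap f ⁻¹' Ω.carrier ∈ residual X}

/-- The set of pairs `(π, Ω)` in `Hom(α, σ) × S₀(Γ, ℕ)` such that `π ⁻¹(Ω)` is comeager. -/
def homGraph : Set (Hom Γ X × Subshift Γ) :=
  {p | p.1.1.ComeagerPreimage p.2.carrier}

end Colorings

end GenericColoring

/-! A subshift is determined by its set of finite patterns, so `Subshift.code` embeds the space of
subshifts in a Cantor space. A set of patterns arises from a subshift exactly when it is closed
under restriction and translation and each pattern extends to any further point. An allowed
extension may take any of infinitely many values, so these conditions are countably many open ones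
rather than closed ones, and the image is a G-delta.

Likewise, a class of Baire measurable maps is determined by which sets U of a countable basis force
`π(x)(γ) = n`. The possible forcing relations form a Borel set (`BaireMap.range_code`), and the code
determines every forcing statement in a Borel way (`BaireMap.measurable_of_code`); hence the space
of classes is standard Borel. Generic equivariance and comeagerness of the preimage of Ω are
countable Boolean combinations of forcing statements and pattern conditions, so `Hom` and `homGraph`
are Borel. Evaluation at 1 and the coding map pass between colorings and equivariant maps, so the
colorable subshifts are the projection of a Borel set. -/

namespace GenericColoring

universe u v w

/-! ### Transfer of Polishness and of standard Borel structure. -/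

section Polish

/-- A countable intersection of open subsets of a Polish space is Polish. -/
theorem polishSpace_iInter_isOpen {ι α : Type*} [Countable ι] [TopologicalSpace α] [PolishSpace α]
    {U : ι → Set α} (hU : ∀ i, IsOpen (U i)) : PolishSpace (⋂ i, U i : Set α) := by
  have hUp : ∀ i, PolishSpace (U i) := fun i => (hU i).polishSpace
  let f : (⋂ i, U i : Set α) → α × (∀ i, U i) :=
    fun x => (x.1, fun i => ⟨x.1, mem_iInter.1 x.2 i⟩)
  have hf : Continuous f := by fun_prop
  have hemb : IsEmbedding f :=
    IsEmbedding.of_comp hf continuous_fst IsEmbedding.subtypeVal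
  -- The diagonal copy of the intersection is cut out of the Polish product by equations, hence is
  -- closed there.
  have hrange : range f = ⋂ i, {z | ((z.2 i : U i) : α) = z.1} := by
    ext z
    simp only [mem_range, mem_iInter, mem_ofPred_eq]
    constructor
    · rintro ⟨x, rfl⟩ i
      rfl
    · intro h
      refine ⟨⟨z.1, mem_iInter.2 fun i => h i ▸ (z.2 i).2⟩, ?_⟩
      exact Prod.ext rfl (funext fun i => Subtype.ext (h i).symm)
  have hclosed : IsClosed (range f) := by
    rw [hrange]
    exact isClosed_iInter fun i => isClosed_eq (by fun_prop) continuous_fst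
  exact (IsClosedEmbedding.mk hemb hclosed).polishSpace

/-- A space measurably isomorphic to a standard Borel space is standard Borel. -/
theorem standardBorelSpace_of_measurableEquiv {α β : Type*} [MeasurableSpace α]
    [MeasurableSpace β] [StandardBorelSpace β] (e : α ≃ᵐ β) : StandardBorelSpace α := by
  let := upgradeStandardBorel β
  let t : TopologicalSpace α := TopologicalSpace.induced e inferInstance
  refine ⟨t, ⟨?_⟩, e.toEquiv.polishSpace_induced⟩
  rw [borel_comap, ← BorelSpace.measurable_eq (α := β)]
  exact e.measurableEmbedding.comap_eq.symm

end Polish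

/-! ### The space of subshifts as a G-delta set of pattern codes. -/

section Subshifts

variable {Γ : Type u} [Group Γ]

/-- The cylinder of all extensions of a finite partial function. -/
def FinPartial.cylinder {Γ : Type u} (φ : FinPartial Γ) : Set (Γ → ℕ) :=
  {ω | ∀ γ : φ.1, ω γ = φ.2 γ}

/-- The restriction of a function to a finite set. -/
def FinPartial.restrict {Γ : Type u} (S : Finset Γ) (ω : Γ → ℕ) : FinPartial Γ :=
  ⟨S, fun γ => ω γ⟩

theorem FinPartial.mem_cylinder_restrict {Γ : Type u} {S : Finset Γ} {ω ω' : Γ → ℕ} :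
    ω' ∈ (FinPartial.restrict S ω).cylinder ↔ ∀ γ ∈ S, ω' γ = ω γ :=
  ⟨fun h γ hγ => h ⟨γ, hγ⟩, fun h γ => h γ.1 γ.2⟩

theorem FinPartial.cylinder_nonempty {Γ : Type u} (φ : FinPartial Γ) : φ.cylinder.Nonempty := by
  classical
  exact ⟨fun γ => if h : γ ∈ φ.1 then φ.2 ⟨γ, h⟩ else 0, fun γ => by simp⟩

theorem FinPartial.isOpen_cylinder {Γ : Type u} (φ : FinPartial Γ) : IsOpen φ.cylinder := by
  have : φ.cylinder = ⋂ γ : φ.1, (fun ω : Γ → ℕ => ω γ) ⁻¹' {φ.2 γ} := by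
    ext ω
    simp [FinPartial.cylinder]
  rw [this]
  exact isOpen_iInter_of_finite fun γ => (isOpen_discrete _).preimage (continuous_apply _)

theorem FinPartial.exists_cylinder_subset {Γ : Type u} {V : Set (Γ → ℕ)} (hV : IsOpen V)
    {ω : Γ → ℕ} (hω : ω ∈ V) : ∃ φ : FinPartial Γ, ω ∈ φ.cylinder ∧ φ.cylinder ⊆ V := by
  obtain ⟨I, t, ht, hI⟩ := isOpen_pi_iff.1 hV ω hω
  refine ⟨FinPartial.restrict I ω, FinPartial.mem_cylinder_restrict.2 fun _ _ => rfl, ?_⟩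
  intro ω' hω'
  refine hI fun γ hγ => ?_
  rw [FinPartial.mem_cylinder_restrict.1 hω' γ hγ]
  exact (ht γ hγ).2

namespace Subshift

/-- This is closedness of the subshift, since cylinders form a basis of the product topology. -/
theorem mem_carrier_iff {Ω : Subshift Γ} {ω : Γ → ℕ} :
    ω ∈ Ω.carrier ↔ ∀ φ : FinPartial Γ, ω ∈ φ.cylinder → φ ∈ Ω.finPatterns := by
  refine ⟨fun h φ hφ => ⟨ω, h, hφ⟩, fun h => ?_⟩
  by_contra hω
  obtain ⟨φ, hφ, hsub⟩ := FinPartial.exists_cylinder_subset Ω.isClosed.isOpen_compl hω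
  obtain ⟨ω', h1, h2⟩ := h φ hφ
  exact hsub h2 h1

open Classical in
/-- The indicator function of the set of patterns of a subshift. -/
noncomputable def code (Ω : Subshift Γ) : FinPartial Γ → Bool :=
  fun φ => decide (φ ∈ Ω.finPatterns)

theorem code_eq_true {Ω : Subshift Γ} {φ : FinPartial Γ} :
    Ω.code φ = true ↔ φ ∈ Ω.finPatterns := by
  simp [code]

theorem code_injective : Function.Injective (code (Γ := Γ)) := by
  intro Ω Ω' h
  ext ω
  simp only [mem_carrier_iff, ← code_eq_true, h]

theorem isClopen_setOf_mem_finPatterns (φ : FinPartial Γ) :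
    IsClopen {Ω : Subshift Γ | φ ∈ Ω.finPatterns} :=
  ⟨⟨TopologicalSpace.isOpen_generateFrom_of_mem ⟨φ, Or.inr rfl⟩⟩,
    TopologicalSpace.isOpen_generateFrom_of_mem ⟨φ, Or.inl rfl⟩⟩

theorem isEmbedding_code : IsEmbedding (code (Γ := Γ)) := by
  refine ⟨⟨le_antisymm ?_ ?_⟩, code_injective⟩
  · rw [← continuous_iff_le_induced]
    refine continuous_pi fun φ => (continuous_bool_rng true).2 ?_
    convert! isClopen_setOf_mem_finPatterns φ using 1
    ext Ω
    simp [code_eq_true]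
  · refine le_generateFrom ?_
    rintro V ⟨φ, rfl | rfl⟩
    · refine ⟨(fun c : FinPartial Γ → Bool => c φ) ⁻¹' {true},
        (isOpen_discrete _).preimage (continuous_apply φ), ?_⟩
      ext Ω
      simp [code_eq_true]
    · refine ⟨(fun c : FinPartial Γ → Bool => c φ) ⁻¹' {true}ᶜ,
        (isOpen_discrete _).preimage (continuous_apply φ), ?_⟩
      ext Ω
      simp [code]

/-- The codes of subshifts: they are closed under restrictions of translates, and every pattern
extends to any further point. -/
def IsPatternCode (c : FinPartial Γ → Bool) : Prop :=
  (∀ p : Γ × FinPartial Γ × FinPartial Γ, (∀ ω ∈ p.2.1.cylinder, shift p.1 ω ∈ p.2.2.cylinder) →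
    c p.2.1 = true → c p.2.2 = true) ∧
  ∀ p : Γ × FinPartial Γ, c p.2 = true →
    ∃ ψ : FinPartial Γ, p.1 ∈ ψ.1 ∧ ψ.cylinder ⊆ p.2.cylinder ∧ c ψ = true

theorem shift_one (ω : Γ → ℕ) : shift 1 ω = ω := by
  funext δ
  simp [shift]

theorem isPatternCode_code (Ω : Subshift Γ) : IsPatternCode Ω.code := by
  classical
  refine ⟨fun ⟨γ, φ, φ'⟩ h hφ => ?_, fun ⟨γ, φ⟩ hφ => ?_⟩
  · obtain ⟨ω, hω, hωφ⟩ := code_eq_true.1 hφ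
    exact code_eq_true.2 ⟨shift γ ω, Ω.shift_mem γ ω hω, h ω hωφ⟩
  · obtain ⟨ω, hω, hωφ⟩ := code_eq_true.1 hφ
    refine ⟨FinPartial.restrict (insert γ φ.1) ω, Finset.mem_insert_self _ _, ?_,
      code_eq_true.2 ⟨ω, hω, FinPartial.mem_cylinder_restrict.2 fun _ _ => rfl⟩⟩
    intro ω' hω' δ
    rw [FinPartial.mem_cylinder_restrict.1 hω' δ (Finset.mem_insert_of_mem δ.2)]
    exact hωφ δ

/-- The subshift of all configurations whose restrictions belong to a pattern code. -/
def ofPatternCode (c : FinPartial Γ → Bool) (hc : IsPatternCode c) : Subshift Γ where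
  carrier := {ω | ∀ φ : FinPartial Γ, ω ∈ φ.cylinder → c φ = true}
  isClosed := by
    have : {ω | ∀ φ : FinPartial Γ, ω ∈ φ.cylinder → c φ = true} =
        ⋂ φ : FinPartial Γ, ⋂ _ : ¬ c φ = true, φ.cylinderᶜ := by
      ext ω
      simp only [mem_ofPred_eq, mem_iInter, mem_compl_iff]
      exact forall_congr' fun φ => not_imp_not.symm
    rw [this]
    exact isClosed_iInter fun φ => isClosed_iInter fun _ => φ.isOpen_cylinder.isClosed_compl
  shift_mem := by
    classical
    intro γ ω hω φ hφ
    -- The values of `shift γ ω` on a finite set S are the values of ω on Sγ.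
    refine hc.1 ⟨γ, FinPartial.restrict (φ.1.image (· * γ)) ω, φ⟩ ?_
      (hω _ (FinPartial.mem_cylinder_restrict.2 fun _ _ => rfl))
    intro ω' hω' δ
    rw [← hφ δ]
    exact FinPartial.mem_cylinder_restrict.1 hω' _ (Finset.mem_image_of_mem _ δ.2)

/-- Enumerate Γ and extend φ repeatedly inside the code so that every point eventually enters the
domain; the limit of these patterns is the required configuration. -/
theorem exists_mem_of_isPatternCode [Countable Γ] {c : FinPartial Γ → Bool}
    (hc : IsPatternCode c) {φ : FinPartial Γ} (hφ : c φ = true) :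
    φ ∈ (ofPatternCode c hc).finPatterns := by
  obtain ⟨e, he⟩ := exists_surjective_nat Γ
  have step : ∀ (n : ℕ) (φ : {φ : FinPartial Γ // c φ = true}),
      ∃ ψ : {φ : FinPartial Γ // c φ = true}, e n ∈ ψ.1.1 ∧ ψ.1.cylinder ⊆ φ.1.cylinder := by
    intro n φ
    obtain ⟨ψ, h1, h2, h3⟩ := hc.2 (e n, φ.1) φ.2
    exact ⟨⟨ψ, h3⟩, h1, h2⟩
  choose next hmem hsub using step
  let ψ : ℕ → {φ : FinPartial Γ // c φ = true} := fun n => Nat.rec ⟨φ, hφ⟩ next n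
  have hanti : Antitone fun n => (ψ n).1.cylinder :=
    antitone_nat_of_succ_le fun n => hsub n (ψ n)
  choose η hη using fun n => (ψ n).1.cylinder_nonempty
  choose k hk using he
  -- The point `e n` enters the domain at stage n + 1, and from that stage on its value is frozen.
  let ω : Γ → ℕ := fun γ => η (k γ + 1) γ
  have key : ∀ γ : Γ, ∀ n, k γ + 1 ≤ n → ∀ ω' ∈ (ψ n).1.cylinder, ω' γ = ω γ := by
    intro γ n hn ω' hω'
    have hγ : γ ∈ (ψ (k γ + 1)).1.1 := by
      have := hmem (k γ) (ψ (k γ))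
      rwa [hk] at this
    exact (hanti hn hω' ⟨γ, hγ⟩).trans (hη (k γ + 1) ⟨γ, hγ⟩).symm
  refine ⟨ω, fun φ' hφ' => ?_, fun γ => ?_⟩
  · let n := φ'.1.sup fun γ => k γ + 1
    -- Stage n already fixes ω on the domain of φ', so φ' is a restriction of `ψ n`; translation by
    -- 1 gives closure under restriction.
    refine hc.1 ⟨1, (ψ n).1, φ'⟩ (fun ω' hω' δ => ?_) (ψ n).2
    rw [shift_one, ← hφ' δ]
    exact key δ n (Finset.le_sup (f := fun γ => k γ + 1) δ.2) ω' hω'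
  · rw [← key γ.1 (k γ.1 + 1) le_rfl (η (k γ.1 + 1)) (hη (k γ.1 + 1))]
    exact hanti (Nat.zero_le (k γ.1 + 1)) (hη (k γ.1 + 1)) γ

theorem range_code [Countable Γ] : range (code (Γ := Γ)) = {c | IsPatternCode c} := by
  ext c
  refine ⟨?_, fun hc => ⟨ofPatternCode c hc, ?_⟩⟩
  · rintro ⟨Ω, rfl⟩
    exact isPatternCode_code Ω
  · funext φ
    rw [Bool.eq_iff_iff, code_eq_true]
    refine ⟨?_, exists_mem_of_isPatternCode hc⟩
    rintro ⟨ω, hω, hωφ⟩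
    exact hω φ hωφ

instance [Countable Γ] : PolishSpace (Subshift Γ) := by
  have hcl : ∀ φ : FinPartial Γ, IsClopen {c : FinPartial Γ → Bool | c φ = true} := fun φ =>
    (isClopen_discrete {true}).preimage (continuous_apply φ)
  let U : (Γ × FinPartial Γ × FinPartial Γ) ⊕ (Γ × FinPartial Γ) → Set (FinPartial Γ → Bool) :=
    Sum.elim
      (fun p => {c | (∀ ω ∈ p.2.1.cylinder, shift p.1 ω ∈ p.2.2.cylinder) →
        c p.2.1 = true → c p.2.2 = true})
      (fun p => {c | c p.2 = true →
        ∃ ψ : FinPartial Γ, p.1 ∈ ψ.1 ∧ ψ.cylinder ⊆ p.2.cylinder ∧ c ψ = true})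
  have hU : ∀ i, IsOpen (U i) := by
    rintro (p | p)
    · simp only [U, Sum.elim_inl, imp_iff_not_or, ofPred_or]
      exact isOpen_const.union ((hcl _).compl.isOpen.union (hcl _).isOpen)
    · simp only [U, Sum.elim_inr, imp_iff_not_or, ofPred_or, ofPred_exists, ofPred_and]
      exact (hcl _).compl.isOpen.union (isOpen_iUnion fun ψ =>
        isOpen_const.inter (isOpen_const.inter (hcl ψ).isOpen))
  have hrange : range (code (Γ := Γ)) = ⋂ i, U i := by
    ext c
    simp [range_code, IsPatternCode, U]
  have hp : PolishSpace (range (code (Γ := Γ))) := by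
    rw [hrange]
    have : ∀ _ : FinPartial Γ, PolishSpace Bool := fun _ => inferInstance
    have : PolishSpace (FinPartial Γ → Bool) := inferInstance
    exact polishSpace_iInter_isOpen hU
  exact isEmbedding_code.toHomeomorph.isClosedEmbedding.polishSpace

end Subshift

end Subshifts

/-! ### Comeagerness in open sets, tested on a countable basis. -/

section BaireCategory

open TopologicalSpace

variable {X : Type v} [TopologicalSpace X]

theorem isMeagre_diff_of_eventuallyEq {P O : Set X} (h : P =ᵇ O) : IsMeagre (O \ P) := by
  have h' : ∀ᶠ x in residual X, (x ∈ P) = (x ∈ O) := h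
  filter_upwards [h'] with x hx
  simp [hx]

theorem IsMeagre.trans_diff {P Q R : Set X} (h₁ : IsMeagre (P \ Q)) (h₂ : IsMeagre (Q \ R)) :
    IsMeagre (P \ R) :=
  (h₁.union h₂).mono fun x hx => by
    by_cases hQ : x ∈ Q
    · exact Or.inr ⟨hQ, hx.2⟩
    · exact Or.inl ⟨hx.1, hQ⟩

variable [SecondCountableTopology X]

theorem isMeagre_diff_iff_forall_countableBasis {U : Set X} (hU : IsOpen U) (P : Set X) :
    IsMeagre (U \ P) ↔ ∀ V : countableBasis X, V.1 ⊆ U → IsMeagre (V.1 \ P) := by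
  refine ⟨fun h V hV => h.mono (sdiff_subset_sdiff_left hV), fun h => ?_⟩
  have hc : (countableBasis X).Countable := countable_countableBasis X
  have := hc.to_subtype
  have hm : IsMeagre (⋃ V : countableBasis X, ⋃ _ : V.1 ⊆ U, V.1 \ P) :=
    isMeagre_iUnion fun V => isMeagre_iUnion fun hV => h V hV
  refine hm.mono fun x hx => ?_
  obtain ⟨V, hV, hxV, hVU⟩ := (isBasis_countableBasis X).exists_subset_of_mem_open hx.1 hU
  exact mem_iUnion.2 ⟨⟨V, hV⟩, mem_iUnion.2 ⟨hVU, hxV, hx.2⟩⟩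

/-- A set with the Baire property is meager in an open set if and only if it is not comeager in any
basic open subset. -/
theorem isMeagre_diff_compl_iff [BaireSpace X] {U P : Set X} (hU : IsOpen U)
    (hP : BaireMeasurableSet P) :
    IsMeagre (U \ Pᶜ) ↔ ∀ V : countableBasis X, V.1 ⊆ U → ¬ IsMeagre (V.1 \ P) := by
  constructor
  · intro h V hV hVP
    refine not_isMeagre_of_isOpen (isOpen_of_mem_countableBasis V.2)
      (nonempty_of_mem_countableBasis V.2) ((h.union hVP).mono fun x hx => ?_)
    by_cases hxP : x ∈ P
    · exact Or.inl ⟨hV hx, fun h => h hxP⟩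
    · exact Or.inr ⟨hx, hxP⟩
  · intro h
    obtain ⟨O, hO, hPO⟩ := hP.residualEq_isOpen
    have hUO : U ∩ O = ∅ := by
      by_contra hne
      obtain ⟨x, hx⟩ := nonempty_iff_ne_empty.2 hne
      obtain ⟨V, hV, -, hVUO⟩ :=
        (isBasis_countableBasis X).exists_subset_of_mem_open hx (hU.inter hO)
      exact h ⟨V, hV⟩ (hVUO.trans inter_subset_left)
        ((isMeagre_diff_of_eventuallyEq hPO).mono
          (sdiff_subset_sdiff_left (hVUO.trans inter_subset_right)))
    have hsub : U \ Pᶜ ⊆ P \ O := fun x hx =>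
      ⟨not_not.1 hx.2, fun hxO => eq_empty_iff_forall_notMem.1 hUO x ⟨hx.1, hxO⟩⟩
    exact (isMeagre_diff_of_eventuallyEq hPO.symm).mono hsub

/-- Sets with the Baire property that are comeager in the same basic open sets agree on a comeager
set. -/
theorem eventuallyEq_of_forall_countableBasis {P Q : Set X} (hP : BaireMeasurableSet P)
    (hQ : BaireMeasurableSet Q)
    (h : ∀ V : countableBasis X, IsMeagre (V.1 \ P) ↔ IsMeagre (V.1 \ Q)) : P =ᵇ Q := by
  have key : ∀ P Q : Set X, BaireMeasurableSet Q →
      (∀ V : countableBasis X, IsMeagre (V.1 \ P) ↔ IsMeagre (V.1 \ Q)) → IsMeagre (Q \ P) := by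
    intro P Q hQ h
    obtain ⟨O, hO, hQO⟩ := hQ.residualEq_isOpen
    have hOQ := isMeagre_diff_of_eventuallyEq hQO
    refine IsMeagre.trans_diff (isMeagre_diff_of_eventuallyEq hQO.symm)
      ((isMeagre_diff_iff_forall_countableBasis hO P).2 fun V hV => (h V).2 ?_)
    exact hOQ.mono (sdiff_subset_sdiff_left hV)
  have h₁ := key P Q hQ h
  have h₂ := key Q P hP fun V => (h V).symm
  have h₃ : (Q \ P)ᶜ ∩ (P \ Q)ᶜ ∈ residual X := inter_mem h₁ h₂
  refine eventuallyEq_set.2 ?_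
  filter_upwards [h₃] with x hx
  simp only [mem_inter_iff, mem_compl_iff, Set.mem_sdiff, not_and, not_not] at hx
  exact ⟨hx.2, hx.1⟩

end BaireCategory

/-! ### Forcing codes and the standard Borel structure on Baire measurable maps. -/

section Codes

open TopologicalSpace

variable {Γ : Type u} {X : Type v} [TopologicalSpace X]

theorem measurableSet_apply_eq (γ : Γ) (n : ℕ) : MeasurableSet {ω : Γ → ℕ | ω γ = n} :=
  measurableSet_eq_fun (measurable_pi_apply γ) measurable_const

theorem isBaireMeasurable_iff_measurable {Y : Type w} [MeasurableSpace Y] {f : X → Y} :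
    IsBaireMeasurable f ↔
      @Measurable _ _ (eventuallyMeasurableSpace (borel X) (residual X)) _ f :=
  ⟨fun h B hB => h B hB, fun h _ hB => h hB⟩

theorem isBaireMeasurable_pi_iff {f : X → Γ → ℕ} :
    IsBaireMeasurable f ↔ ∀ γ n, BaireMeasurableSet {x | f x γ = n} := by
  refine ⟨fun h γ n => h {ω | ω γ = n} (measurableSet_apply_eq γ n),
    fun h => isBaireMeasurable_iff_measurable.2 ?_⟩
  let := eventuallyMeasurableSpace (borel X) (residual X)
  exact measurable_pi_iff.2 fun γ => measurable_to_countable' fun n => h γ n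

namespace BaireMap

section Forcing

variable {Y : Type w} [MeasurableSpace Y]

theorem measurableSet_setOf_forces {U : Set X} (hU : IsOpen U)
    {A : Set Y} (hA : MeasurableSet A) :
    MeasurableSet {π : BaireMap X Y | Forces U A π} := by
  rcases U.eq_empty_or_nonempty with rfl | hne
  · convert! MeasurableSet.univ
    refine eq_univ_of_forall fun π => ?_
    refine Quotient.inductionOn π fun f => ?_
    change IsMeagre (∅ \ _)
    simpa using IsMeagre.empty
  · exact MeasurableSpace.measurableSet_generateFrom ⟨U, A, hU, hne, hA, rfl⟩

theorem forces_iInter_iff (U : Set X) (A : ℕ → Set Y) (π : BaireMap X Y) :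
    Forces U (⋂ i, A i) π ↔ ∀ i, Forces U (A i) π := by
  refine Quotient.inductionOn π fun f => ?_
  change IsMeagre (U \ f.1 ⁻¹' ⋂ i, A i) ↔ ∀ i, IsMeagre (U \ f.1 ⁻¹' A i)
  rw [preimage_iInter, sdiff_iInter]
  exact ⟨fun h i => h.mono (subset_iUnion (fun i => U \ f.1 ⁻¹' A i) i), fun h => isMeagre_iUnion h⟩

end Forcing

variable [SecondCountableTopology X]

/-- `U` forces `π(x)(γ) = n`. -/
def code (π : BaireMap X (Γ → ℕ)) (p : countableBasis X × Γ × ℕ) : Prop :=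
  Forces p.1.1 {ω | ω p.2.1 = p.2.2} π

section Forcing

variable {Y : Type w} [MeasurableSpace Y]

theorem forces_iff_forall_countableBasis {U : Set X} (hU : IsOpen U) (A : Set Y)
    (π : BaireMap X Y) :
    Forces U A π ↔ ∀ V : countableBasis X, V.1 ⊆ U → Forces V.1 A π :=
  Quotient.inductionOn π fun f => isMeagre_diff_iff_forall_countableBasis hU (f.1 ⁻¹' A)

/-- The forcing clause for negation: it turns complements into a countable quantifier, which keeps
forcing statements Borel. -/
theorem forces_compl_iff [BaireSpace X] {U : Set X} (hU : IsOpen U) {A : Set Y}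
    (hA : MeasurableSet A) (π : BaireMap X Y) :
    Forces U Aᶜ π ↔ ∀ V : countableBasis X, V.1 ⊆ U → ¬ Forces V.1 A π :=
  Quotient.inductionOn π fun f => isMeagre_diff_compl_iff hU (f.2 A hA)

end Forcing

/-- The codes of Baire measurable maps: each `c (·, γ, n)` is the set of basic open subsets of a
regular open set, these are disjoint for distinct `n`, and their union is dense. -/
def IsForcingCode (c : countableBasis X × Γ × ℕ → Prop) : Prop :=
  (∀ (U : countableBasis X) γ n, c (U, γ, n) ↔
    ∀ V : countableBasis X, V.1 ⊆ U.1 → ∃ W : countableBasis X, W.1 ⊆ V.1 ∧ c (W, γ, n)) ∧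
  (∀ (U : countableBasis X) γ m n, c (U, γ, m) → c (U, γ, n) → m = n) ∧
  ∀ (U : countableBasis X) γ, ∃ V : countableBasis X, V.1 ⊆ U.1 ∧ ∃ n, c (V, γ, n)

theorem isForcingCode_code [BaireSpace X] (π : BaireMap X (Γ → ℕ)) : IsForcingCode π.code := by
  have hA : ∀ γ n, MeasurableSet {ω : Γ → ℕ | ω γ = n} := measurableSet_apply_eq
  have ho : ∀ V : countableBasis X, IsOpen V.1 := fun V => isOpen_of_mem_countableBasis V.2
  refine ⟨fun U γ n => ?_, fun U γ m n => ?_, fun U γ => ?_⟩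
  -- Applying the negation clause to a double complement yields the regularity condition.
  · change Forces U.1 _ π ↔ _
    rw [← compl_compl {ω : Γ → ℕ | ω γ = n}, forces_compl_iff (ho U) (hA γ n).compl]
    refine forall_congr' fun V => imp_congr_right fun _ => ?_
    rw [forces_compl_iff (ho V) (hA γ n)]
    push Not
    rfl
  · refine Quotient.inductionOn π fun f hm hn => ?_
    by_contra hmn
    refine not_isMeagre_of_isOpen (ho U) (nonempty_of_mem_countableBasis U.2)
      ((IsMeagre.union hm hn).mono fun x hx => ?_)
    by_cases hxm : f.1 x γ = m
    · exact Or.inr ⟨hx, fun h => hmn (hxm.symm.trans h)⟩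
    · exact Or.inl ⟨hx, hxm⟩
  · by_contra! h
    have h' : ∀ n, Forces U.1 {ω : Γ → ℕ | ω γ = n}ᶜ π := fun n =>
      (forces_compl_iff (ho U) (hA γ n) π).2 fun V hV => h V hV n
    have h₂ := (forces_iInter_iff _ _ _).2 h'
    have hempty : ⋂ n, {ω : Γ → ℕ | ω γ = n}ᶜ = ∅ := by
      ext ω
      simp
    rw [hempty] at h₂
    revert h₂
    refine Quotient.inductionOn π fun f h₂ => ?_
    change IsMeagre (U.1 \ ∅) at h₂
    rw [sdiff_empty] at h₂
    exact not_isMeagre_of_isOpen (ho U) (nonempty_of_mem_countableBasis U.2) h₂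

/-- The basic sets that c assigns to (γ, n) unite to an open set `O γ n`. For fixed γ these are
disjoint with dense union, so they define a map generically; regularity ensures that it forces
nothing beyond c. -/
theorem exists_code_eq [BaireSpace X] {c : countableBasis X × Γ × ℕ → Prop}
    (hc : IsForcingCode c) : ∃ π : BaireMap X (Γ → ℕ), π.code = c := by
  obtain ⟨hreg, hdisj, hdense⟩ := hc
  have ho : ∀ V : countableBasis X, IsOpen V.1 := fun V => isOpen_of_mem_countableBasis V.2
  have hsub : ∀ {U : Set X}, IsOpen U → U.Nonempty → ∃ V : countableBasis X, V.1 ⊆ U := by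
    rintro U hU ⟨x, hx⟩
    obtain ⟨V, hV, -, hVU⟩ := (isBasis_countableBasis X).exists_subset_of_mem_open hx hU
    exact ⟨⟨V, hV⟩, hVU⟩
  have hmono : ∀ {U V : countableBasis X} {γ : Γ} {n : ℕ}, V.1 ⊆ U.1 → c (U, γ, n) →
      c (V, γ, n) := fun {U V γ n} hVU hU =>
    (hreg V γ n).2 fun W hW => (hreg U γ n).1 hU W (hW.trans hVU)
  let O : Γ → ℕ → Set X := fun γ n => ⋃ U : countableBasis X, ⋃ _ : c (U, γ, n), U.1
  have hOo : ∀ γ n, IsOpen (O γ n) := fun γ n =>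
    isOpen_iUnion fun U => isOpen_iUnion fun _ => ho U
  have hOd : ∀ {γ x m n}, x ∈ O γ m → x ∈ O γ n → m = n := by
    intro γ x m n hm hn
    simp only [O, mem_iUnion] at hm hn
    obtain ⟨U, hU, hxU⟩ := hm
    obtain ⟨V, hV, hxV⟩ := hn
    obtain ⟨W, hW⟩ := hsub ((ho U).inter (ho V)) ⟨x, hxU, hxV⟩
    exact hdisj W γ m n (hmono (hW.trans inter_subset_left) hU)
      (hmono (hW.trans inter_subset_right) hV)
  have hD : ∀ γ, (⋃ n, O γ n) ∈ residual X := by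
    intro γ
    refine residual_of_dense_open (isOpen_iUnion (hOo γ)) (dense_iff_inter_open.2 ?_)
    intro U hU hne
    obtain ⟨V, hVU⟩ := hsub hU hne
    obtain ⟨W, hWV, n, hW⟩ := hdense V γ
    obtain ⟨x, hx⟩ := nonempty_of_mem_countableBasis W.2
    exact ⟨x, hVU (hWV hx), mem_iUnion.2 ⟨n, mem_iUnion.2 ⟨W, mem_iUnion.2 ⟨hW, hx⟩⟩⟩⟩
  -- The set has at most one element; off the comeager union it is empty and the value is 0.
  let f : X → Γ → ℕ := fun x γ => sInf {n | x ∈ O γ n}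
  have hfO : ∀ {γ x n}, x ∈ O γ n → f x γ = n := by
    intro γ x n hx
    have hs : {m | x ∈ O γ m} = {n} := by
      ext m
      exact ⟨fun hm => hOd hm hx, fun hm => by rw [mem_singleton_iff.1 hm]; exact hx⟩
    simp only [f, hs, csInf_singleton]
  have hfeq : ∀ γ n, O γ n =ᵇ {x | f x γ = n} := by
    intro γ n
    refine eventuallyEq_set.2 ?_
    filter_upwards [hD γ] with x hx
    refine ⟨hfO, fun h => ?_⟩
    obtain ⟨m, hm⟩ := mem_iUnion.1 hx
    have hmn : m = n := (hfO hm).symm.trans h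
    exact hmn ▸ hm
  have hf : IsBaireMeasurable f :=
    isBaireMeasurable_pi_iff.2 fun γ n => (hOo γ n).baireMeasurableSet.congr (hfeq γ n)
  refine ⟨Quotient.mk (starEq X (Γ → ℕ)) ⟨f, hf⟩, ?_⟩
  funext ⟨U, γ, n⟩
  refine propext ⟨fun h => (hreg U γ n).2 fun V hV => ?_, fun h => ?_⟩
  · have hVO : IsMeagre (V.1 \ O γ n) :=
      IsMeagre.trans_diff (IsMeagre.mono (sdiff_subset_sdiff_left hV) h)
        (isMeagre_diff_of_eventuallyEq (hfeq γ n))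
    have hne : (V.1 ∩ O γ n).Nonempty := by
      by_contra hne
      have hVe : V.1 \ O γ n = V.1 :=
        sdiff_eq_left.2 (disjoint_iff_inter_eq_empty.2 (not_nonempty_iff_eq_empty.1 hne))
      rw [hVe] at hVO
      exact not_isMeagre_of_isOpen (ho V) (nonempty_of_mem_countableBasis V.2) hVO
    obtain ⟨x, hxV, hxO⟩ := hne
    simp only [O, mem_iUnion] at hxO
    obtain ⟨W, hW, hxW⟩ := hxO
    obtain ⟨W', hW'⟩ := hsub ((ho V).inter (ho W)) ⟨x, hxV, hxW⟩
    exact ⟨W', hW'.trans inter_subset_left, hmono (hW'.trans inter_subset_right) hW⟩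
  · change IsMeagre (U.1 \ {x | f x γ = n})
    have hUO : U.1 ⊆ {x | f x γ = n} := fun x hx =>
      hfO (mem_iUnion.2 ⟨U, mem_iUnion.2 ⟨h, hx⟩⟩)
    rw [sdiff_eq_empty.2 hUO]
    exact IsMeagre.empty

theorem range_code [BaireSpace X] :
    range (code (Γ := Γ) (X := X)) = {c | IsForcingCode c} := by
  ext c
  refine ⟨?_, fun hc => exists_code_eq hc⟩
  rintro ⟨π, rfl⟩
  exact isForcingCode_code π

theorem measurable_code : Measurable (code (Γ := Γ) (X := X)) := by
  refine measurable_pi_iff.2 fun p => measurableSet_setOfPred.1 ?_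
  exact measurableSet_setOf_forces (isOpen_of_mem_countableBasis p.1.2)
    (measurableSet_apply_eq p.2.1 p.2.2)

/-- A family of Baire measurable maps into `ℕ ^ Γ` is measurable as soon as its codes are. -/
theorem measurable_of_code [BaireSpace X] {Z : Type w} [MeasurableSpace Z]
    {F : Z → BaireMap X (Γ → ℕ)} (hF : ∀ p, MeasurableSet {z | (F z).code p}) : Measurable F := by
  have hc : (countableBasis X).Countable := countable_countableBasis X
  have := hc.to_subtype
  have compl : ∀ A : Set (Γ → ℕ), MeasurableSet A →
      (∀ U : Set X, IsOpen U → MeasurableSet {z | Forces U A (F z)}) →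
      ∀ U : Set X, IsOpen U → MeasurableSet {z | Forces U Aᶜ (F z)} := by
    intro A hA h U hU
    simp only [forces_compl_iff hU hA]
    exact measurableSet_setOfPred.2 <| Measurable.forall fun V =>
      measurable_const.imp (measurableSet_setOfPred.1 (h V.1 (isOpen_of_mem_countableBasis V.2))).not
  -- Good sets principle: the sets A whose forcing by any open U is measurable in z form a
  -- σ-algebra, and it contains the generators `{ω | ω γ = n}`.
  let G : MeasurableSpace (Γ → ℕ) :=
    { MeasurableSet' A :=
        MeasurableSet A ∧ ∀ U : Set X, IsOpen U → MeasurableSet {z | Forces U A (F z)}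
      measurableSet_empty := by
        refine ⟨MeasurableSet.empty, ?_⟩
        rw [← compl_univ]
        refine compl _ MeasurableSet.univ fun U _ => ?_
        convert! MeasurableSet.univ
        refine eq_univ_of_forall fun z => ?_
        exact Quotient.inductionOn (motive := Forces U univ) (F z) fun f => by
          change IsMeagre (U \ f.1 ⁻¹' univ)
          simpa using IsMeagre.empty
      measurableSet_compl := fun A hA => ⟨hA.1.compl, compl A hA.1 hA.2⟩
      measurableSet_iUnion := by
        intro A hA
        refine ⟨MeasurableSet.iUnion fun i => (hA i).1, ?_⟩
        have h : ⋃ i, A i = (⋂ i, (A i)ᶜ)ᶜ := by simp [compl_iInter]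
        rw [h]
        refine compl _ (MeasurableSet.iInter fun i => (hA i).1.compl) fun U hU => ?_
        simp only [forces_iInter_iff]
        exact measurableSet_setOfPred.2 <| Measurable.forall fun i =>
          measurableSet_setOfPred.1 (compl _ (hA i).1 (hA i).2 U hU) }
  have hG : (MeasurableSpace.pi : MeasurableSpace (Γ → ℕ)) ≤ G := by
    refine iSup_le fun γ => MeasurableSpace.comap_le_iff_le_map.2 ?_
    refine Measurable.of_le_map (?_ : @Measurable _ _ G _ fun ω : Γ → ℕ => ω γ) |>.le_map
    refine @measurable_to_countable' _ _ _ _ G _ fun n =>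
      ⟨measurableSet_apply_eq γ n, fun U hU => ?_⟩
    simp only [forces_iff_forall_countableBasis hU]
    exact measurableSet_setOfPred.2 <| Measurable.forall fun V =>
      measurable_const.imp (measurableSet_setOfPred.1 (hF (V, γ, n)))
  refine measurable_generateFrom ?_
  rintro S ⟨U, A, hU, -, hA, rfl⟩
  exact (hG A hA).2 U hU

section Countable

variable [Countable Γ]

theorem eventuallyEq_of_code_eq {f g : X → Γ → ℕ} (hf : IsBaireMeasurable f)
    (hg : IsBaireMeasurable g)
    (h : ∀ (V : countableBasis X) γ n,
      IsMeagre (V.1 \ {x | f x γ = n}) ↔ IsMeagre (V.1 \ {x | g x γ = n})) :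
    f =ᵇ g := by
  have h' : ∀ᶠ x in residual X, ∀ γ, ∀ n, (f x γ = n ↔ g x γ = n) :=
    eventually_countable_forall.2 fun γ => eventually_countable_forall.2 fun n =>
      eventuallyEq_set.1 (eventuallyEq_of_forall_countableBasis
        (isBaireMeasurable_pi_iff.1 hf γ n) (isBaireMeasurable_pi_iff.1 hg γ n)
        fun V => h V γ n)
  filter_upwards [h'] with x hx
  funext γ
  exact ((hx γ _).1 rfl).symm

theorem code_injective : Function.Injective (code (Γ := Γ) (X := X)) := by
  intro π ρ
  refine Quotient.inductionOn₂ π ρ fun f g h => Quotient.sound ?_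
  exact eventuallyEq_of_code_eq f.2 g.2 fun V γ n => iff_of_eq (congrFun h (V, γ, n))

theorem measurableSet_setOf_isForcingCode :
    MeasurableSet {c : countableBasis X × Γ × ℕ → Prop | IsForcingCode c} := by
  have hc : (countableBasis X).Countable := countable_countableBasis X
  have := hc.to_subtype
  have hm : ∀ p, Measurable fun c : countableBasis X × Γ × ℕ → Prop => c p :=
    fun p => measurable_pi_apply p
  refine measurableSet_setOfPred.2 (Measurable.and ?_ (Measurable.and ?_ ?_))
  · refine Measurable.forall fun U => Measurable.forall fun γ => Measurable.forall fun n =>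
      (hm _).iff (Measurable.forall fun V => measurable_const.imp (Measurable.exists fun W =>
        measurable_const.and (hm _)))
  · exact Measurable.forall fun U => Measurable.forall fun γ => Measurable.forall fun m =>
      Measurable.forall fun n => (hm _).imp ((hm _).imp measurable_const)
  · exact Measurable.forall fun U => Measurable.forall fun γ => Measurable.exists fun V =>
      measurable_const.and (Measurable.exists fun n => hm _)

instance [BaireSpace X] : StandardBorelSpace (BaireMap X (Γ → ℕ)) := by
  have hc : (countableBasis X).Countable := countable_countableBasis X
  have := hc.to_subtype
  have hr : MeasurableSet (range (code (Γ := Γ) (X := X))) := by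
    rw [range_code]
    exact measurableSet_setOf_isForcingCode
  have := hr.standardBorel
  let e := Equiv.ofInjective _ (code_injective (Γ := Γ) (X := X))
  have he : ∀ z, (e.symm z).code = z.1 := fun z => Equiv.apply_ofInjective_symm code_injective z
  refine standardBorelSpace_of_measurableEquiv
    (β := range (code (Γ := Γ) (X := X))) ⟨e, measurable_code.subtype_mk, ?_⟩
  refine measurable_of_code fun p => ?_
  simp only [he]
  exact measurableSet_setOfPred.2 ((measurable_pi_apply p).comp measurable_subtype_coe)

end Countable

end BaireMap

end Codes

/-! ### Borelness of `Hom` and `homGraph`, and the projection. -/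

section Equivariance

open TopologicalSpace

variable {Γ : Type u} [Group Γ] {X : Type v} [TopologicalSpace X] [MulAction Γ X]
  [ContinuousConstSMul Γ X]

theorem isMeagre_smul_image_iff (γ : Γ) (U P : Set X) :
    IsMeagre (((γ • ·) '' U) \ P) ↔ IsMeagre (U \ (γ • ·) ⁻¹' P) := by
  have h : ∀ (δ : Γ) (Q : Set X), IsMeagre Q → IsMeagre ((δ • ·) ⁻¹' Q) := fun δ Q hQ =>
    hQ.preimage_of_isOpenMap (Homeomorph.smul δ).continuous (Homeomorph.smul δ).isOpenMap
  have hs : (γ • ·) ⁻¹' (((γ • ·) '' U) \ P) = U \ (γ • ·) ⁻¹' P := by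
    rw [preimage_sdiff, preimage_image_eq _ (MulAction.injective γ)]
  refine ⟨fun hm => hs ▸ h γ _ hm, fun hm => ?_⟩
  have := h γ⁻¹ _ (hs.symm ▸ hm)
  simpa [← preimage_comp, Function.comp_def] using this

variable (Γ X) [Countable Γ]

/-- For each γ, the maps x ↦ π(γx) and x ↦ γ·π(x) agree generically iff their forcing codes agree.
Translating the basic set by γ expresses the code of the former through π itself. -/
theorem measurableSet_hom [SecondCountableTopology X] : MeasurableSet (Hom Γ X) := by
  have hc : (countableBasis X).Countable := countable_countableBasis X
  have := hc.to_subtype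
  have hHom : Hom Γ X = {π | ∀ (γ : Γ) (V : countableBasis X) (δ : Γ) (n : ℕ),
      BaireMap.Forces ((γ • ·) '' V.1) {ω | ω δ = n} π ↔
        BaireMap.Forces V.1 {ω | ω (δ * γ) = n} π} := by
    ext π
    refine Quotient.inductionOn π fun f => ?_
    change {x | ∀ γ : Γ, f.1 (γ • x) = shift γ (f.1 x)} ∈ residual X ↔
      ∀ (γ : Γ) (V : countableBasis X) (δ : Γ) (n : ℕ),
        IsMeagre (((γ • ·) '' V.1) \ {x | f.1 x δ = n}) ↔
          IsMeagre (V.1 \ {x | f.1 x (δ * γ) = n})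
    simp only [isMeagre_smul_image_iff]
    have hf := isBaireMeasurable_pi_iff.1 f.2
    constructor
    · intro h γ V δ n
      have he : (γ • ·) ⁻¹' {x | f.1 x δ = n} =ᵇ {x | f.1 x (δ * γ) = n} := by
        refine eventuallyEq_set.2 ?_
        filter_upwards [h] with x hx
        have := congrFun (hx γ) δ
        simp only [mem_preimage, mem_ofPred_eq, this, shift]
      exact ⟨fun hm => IsMeagre.trans_diff hm (isMeagre_diff_of_eventuallyEq he.symm),
        fun hm => IsMeagre.trans_diff hm (isMeagre_diff_of_eventuallyEq he)⟩
    · intro h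
      refine eventually_countable_forall.2 fun γ => ?_
      refine BaireMap.eventuallyEq_of_code_eq (f := fun x => f.1 (γ • x))
        (g := fun x => shift γ (f.1 x)) (isBaireMeasurable_pi_iff.2 fun δ n => ?_)
        (isBaireMeasurable_pi_iff.2 fun δ n => hf (δ * γ) n) fun V δ n => h γ V δ n
      exact (hf δ n).preimage (Homeomorph.smul γ).continuous (Homeomorph.smul γ).isOpenMap
  rw [hHom]
  have hm : ∀ (U : Set X) (δ : Γ) (n : ℕ), IsOpen U → Measurable fun π : BaireMap X (Γ → ℕ) =>
      BaireMap.Forces U {ω : Γ → ℕ | ω δ = n} π := fun U δ n hU =>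
    measurableSet_setOfPred.1 (BaireMap.measurableSet_setOf_forces hU
      (measurableSet_apply_eq δ n))
  refine measurableSet_setOfPred.2 <| Measurable.forall fun γ => Measurable.forall fun V =>
    Measurable.forall fun δ => Measurable.forall fun n => ?_
  have hV := isOpen_of_mem_countableBasis V.2
  exact (hm _ δ n ((Homeomorph.smul γ).isOpenMap _ hV)).iff (hm _ (δ * γ) n hV)

/-- As there are countably many patterns, π(x) lies in Ω generically iff each pattern outside Fin(Ω)
is generically avoided by π(x). -/
theorem measurableSet_homGraph [SecondCountableTopology X] : MeasurableSet (homGraph Γ X) := by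
  have hgraph : homGraph Γ X = {p | ∀ φ : FinPartial Γ, φ ∈ p.2.finPatterns ∨
      BaireMap.Forces univ φ.cylinderᶜ p.1.1} := by
    ext ⟨⟨π, hπ⟩, Ω⟩
    change π.ComeagerPreimage Ω.carrier ↔
      ∀ φ : FinPartial Γ, φ ∈ Ω.finPatterns ∨ BaireMap.Forces univ φ.cylinderᶜ π
    refine Quotient.inductionOn π fun f => ?_
    change (∀ᶠ x in residual X, f.1 x ∈ Ω.carrier) ↔
      ∀ φ : FinPartial Γ, φ ∈ Ω.finPatterns ∨ IsMeagre (univ \ f.1 ⁻¹' φ.cylinderᶜ)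
    simp only [Subshift.mem_carrier_iff]
    rw [eventually_countable_forall]
    refine forall_congr' fun φ => ?_
    rw [← compl_eq_univ_sdiff, IsMeagre, compl_compl]
    by_cases hφ : φ ∈ Ω.finPatterns
    · simp [hφ]
    · simp only [hφ, imp_false, false_or]
      rfl
  rw [hgraph]
  refine measurableSet_setOfPred.2 <| Measurable.forall fun φ => Measurable.or ?_ ?_
  · exact measurableSet_setOfPred.1
      ((Subshift.isClopen_setOf_mem_finPatterns φ).isOpen.measurableSet.preimage measurable_snd)
  · exact measurableSet_setOfPred.1
      ((BaireMap.measurableSet_setOf_forces isOpen_univ φ.isOpen_cylinder.measurableSet.compl).preimage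
        (measurable_subtype_coe.comp measurable_fst))

theorem baireColorable_eq_image : baireColorable Γ X = Prod.snd '' homGraph Γ X := by
  ext Ω
  constructor
  · rintro ⟨f, hf, hΩ⟩
    have hπ : IsBaireMeasurable (codingMap (Γ := Γ) f) :=
      isBaireMeasurable_pi_iff.2 fun γ n =>
        (hf {n} (measurableSet_singleton n)).preimage (Homeomorph.smul γ).continuous
          (Homeomorph.smul γ).isOpenMap
    refine ⟨(⟨Quotient.mk (starEq X (Γ → ℕ)) ⟨codingMap f, hπ⟩, ?_⟩, Ω), hΩ, rfl⟩
    change {x | ∀ γ : Γ, codingMap f (γ • x) = shift γ (codingMap f x)} ∈ residual X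
    refine Eventually.of_forall fun x γ => ?_
    funext δ
    simp only [codingMap, shift, mul_smul]
  · rintro ⟨⟨⟨π, hπ⟩, Ω⟩, h, rfl⟩
    revert hπ h
    refine Quotient.inductionOn π fun f hπ h => ?_
    change {x | ∀ γ : Γ, f.1 (γ • x) = shift γ (f.1 x)} ∈ residual X at hπ
    change f.1 ⁻¹' Ω.carrier ∈ residual X at h
    refine ⟨fun x => f.1 x 1, fun B hB => f.2 _ (measurable_pi_apply 1 hB), ?_⟩
    filter_upwards [hπ, h] with x hx hxΩ
    have : codingMap (Γ := Γ) (fun x => f.1 x 1) x = f.1 x := by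
      funext γ
      simp only [codingMap, hx γ, shift, one_mul]
    rw [mem_preimage, this]
    exact hxΩ

end Equivariance

end GenericColoring

theorem corollary4 {Γ : Type*} [Group Γ] [Countable Γ] [Infinite Γ]
    {X : Type*} [TopologicalSpace X] [PolishSpace X] [MulAction Γ X] [ContinuousConstSMul Γ X] :
    PolishSpace (GenericColoring.Subshift Γ) ∧
    MeasureTheory.AnalyticSet (GenericColoring.baireColorable Γ X) ∧
    MeasurableSet (GenericColoring.Hom Γ X) ∧
    StandardBorelSpace (GenericColoring.Hom Γ X) ∧
    MeasurableSet (GenericColoring.homGraph Γ X) ∧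
    GenericColoring.baireColorable Γ X = Prod.snd '' GenericColoring.homGraph Γ X := by
  have hHom := GenericColoring.measurableSet_hom Γ X
  have hStd : StandardBorelSpace (GenericColoring.Hom Γ X) := hHom.standardBorel
  have hgraph := GenericColoring.measurableSet_homGraph Γ X
  have heq := GenericColoring.baireColorable_eq_image Γ X
  exact ⟨inferInstance, heq ▸ hgraph.analyticSet_image measurable_snd, hHom, hStd, hgraph, heq⟩
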